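/- Let $A_1,\dots,A_m$ and $B$ be real symmetric $n\times n$ matrices. Write $S\preceq T$ if $T-S$ is positive semidefinite, and $S\bullet T=\sum_{i,j}s_{ij}t_{ij}$. Consider the semidefinite system $$P_{SD}=\Big\{x\in\mathbb R^m : \sum_{i=1}^m x_iA_i\preceq B\Big\}.$$ It is called well-behaved if for every $c\in\mathbb R^m$ for which $\sup\{\sum_i c_ix_i : x\in P_{SD}\}$ is finite there is a positive semidefinite $Y$ with $A_i\bullet Y=c_i$ for all $i$ such that $B\bullet Y$ equals this supremum; otherwise it is called badly behaved. A slack is a matrix $B-\sum_i x_iA_i$ with $x\in P_{SD}$. Assume that $P_{SD}$ is nonempty, let $Z$ be a slack of maximum rank, and let $r$ be the rank of $Z$. Then $P_{SD}$ is badly behaved if and only if there is an invertible $n\times n$ matrix $T$ with $$T^{T}ZT=\begin{pmatrix} I_r&0\\0&0\end{pmatrix}$$ such that some linear combination $V$ of $T^TA_1T,\dots,T^TA_mT$ and $T^TBT$ has the form $$V=\begin{pmatrix} V_{11}&e_1&*\\ e_1^T&0&0\\ *&0&V_{33}\end{pmatrix},$$ where $V_{11}$ is $r\times r$, the middle row and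 column are the $(r+1)$-st ones of $V$, $e_1\in\mathbb R^r$ is the first unit vector, $V_{33}$ is positive semidefinite of order $n-r-1$ (possibly empty), and the stars denote arbitrary entries. (In particular, $V$ can have this form only if $1\le r\le n-1$.) -/

import Mathlib

namespace SDPSystem

/-- The inner product `S • T = ∑ i j, s_ij t_ij` of square matrices. -/
def frobInner {n : ℕ} (S T : Matrix (Fin n) (Fin n) ℝ) : ℝ :=
  ∑ i, ∑ j, S i j * T i j

/-- The solution set of the semidefinite system `∑ i, x_i A_i ⪯ B`. -/
def feasibleSet {m n : ℕ} (A : Fin m → Matrix (Fin n) (Fin n) ℝ)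
    (B : Matrix (Fin n) (Fin n) ℝ) : Set (Fin m → ℝ) :=
  {x | (B - ∑ i, x i • A i).PosSemidef}

/-- The feasible set of the dual semidefinite program with objective vector `c`:
positive semidefinite `Y` with `A_i • Y = c_i` for all `i`. -/
def dualFeasibleSet {m n : ℕ} (A : Fin m → Matrix (Fin n) (Fin n) ℝ) (c : Fin m → ℝ) :
    Set (Matrix (Fin n) (Fin n) ℝ) :=
  {Y | Y.PosSemidef ∧ ∀ i, frobInner (A i) Y = c i}

/-- The system is well-behaved if, for every objective `c` for which the supremum of `⟨c, x⟩`
over the system is a (finite) real number `v`, some dual feasible `Y` has value `B • Y = v`.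
(The empty set of reals has no least upper bound, so its value is not finite.) -/
def WellBehaved {m n : ℕ} (A : Fin m → Matrix (Fin n) (Fin n) ℝ)
    (B : Matrix (Fin n) (Fin n) ℝ) : Prop :=
  ∀ (c : Fin m → ℝ) (v : ℝ), IsLUB ((fun x => ∑ i, c i * x i) '' feasibleSet A B) v →
    ∃ Y ∈ dualFeasibleSet A c, frobInner B Y = v

/-- The system is badly behaved if it is not well-behaved. -/
def BadlyBehaved {m n : ℕ} (A : Fin m → Matrix (Fin n) (Fin n) ℝ)
    (B : Matrix (Fin n) (Fin n) ℝ) : Prop :=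
  ¬ WellBehaved A B

/-- `Z` is a slack: `Z = B - ∑ i, x_i A_i` for a solution `x` of the system. -/
def IsSlack {m n : ℕ} (A : Fin m → Matrix (Fin n) (Fin n) ℝ)
    (B Z : Matrix (Fin n) (Fin n) ℝ) : Prop :=
  ∃ x ∈ feasibleSet A B, Z = B - ∑ i, x i • A i

/-- `Z` is a slack of maximum rank. -/
def IsMaxRankSlack {m n : ℕ} (A : Fin m → Matrix (Fin n) (Fin n) ℝ)
    (B Z : Matrix (Fin n) (Fin n) ℝ) : Prop :=
  IsSlack A B Z ∧ ∀ Z', IsSlack A B Z' → Z'.rank ≤ Z.rank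

/-- The `n × n` matrix `I_r ⊕ 0`. -/
def idZero (n r : ℕ) : Matrix (Fin n) (Fin n) ℝ :=
  Matrix.diagonal fun i => if (i : ℕ) < r then 1 else 0

/-- The rotation (congruence) `M ↦ Tᵀ M T`. -/
def rotate {n : ℕ} (T M : Matrix (Fin n) (Fin n) ℝ) : Matrix (Fin n) (Fin n) ℝ :=
  T.transpose * M * T

/-- `V` is a linear combination of the `A_i` and `B`. -/
def IsLinComb {m n : ℕ} (A : Fin m → Matrix (Fin n) (Fin n) ℝ)
    (B V : Matrix (Fin n) (Fin n) ℝ) : Prop :=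
  ∃ (v : Fin m → ℝ) (v₀ : ℝ), V = ∑ i, v i • A i + v₀ • B

/-- `V` is symmetric of the block form, with blocks of orders `r`, `1`, `n - r - 1`,
```
V₁₁   e₁   *
e₁ᵀ   0    0
*     0    V₃₃
```
with `V₃₃` positive semidefinite (possibly empty). Rows are indexed from `0`, so the middle
row and column have index `r`. The form needs `1 ≤ r` (so that `e₁` exists) and `r < n` (so that
the middle row exists). -/
def HasBadForm {n : ℕ} (r : ℕ) (V : Matrix (Fin n) (Fin n) ℝ) : Prop :=
  V.IsSymm ∧ 1 ≤ r ∧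
    (∃ k : Fin n, (k : ℕ) = r ∧ ∀ i : Fin n, V i k = if (i : ℕ) = 0 then 1 else 0) ∧
    (V.submatrix (fun i : {i : Fin n // r < (i : ℕ)} => (i : Fin n))
      (fun j : {j : Fin n // r < (j : ℕ)} => (j : Fin n))).PosSemidef

end SDPSystem

namespace SDPSystem

open Matrix

variable {m n : ℕ}

/-! Bad behaviour and the normal form are both equivalent to a critical direction at Z
(`HasCriticalDirection`): a combination W of the A_i, nonnegative on ker Z, and some w in ker Z with
wᵀWw = 0 but Ww ≠ 0. Maximality of the rank enters through the fact that ker Z lies in the kernel of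
every slack.

Given (W, w), the objective c_i = -(Ww)ᵀA_i w is constant on the feasible set. A dual solution Y
with that value would be supported on ker Z, so that W • Y ≥ 0, whereas the dual equations give W •
Y = -|Ww|². The normal form is the same pair written in a basis adapted to ker Z and orthonormal for
Z + Q, where Q is the orthogonal projection onto ker Z.

If there is no critical direction, Finsler's lemma makes Z + εW a slack for some ε > 0 whenever QWQ
is positive semidefinite, and hence WQ = 0. A dual optimum is then the sum of two pieces. Slater
duality on the combinations that kill ker Z supplies the value. A piece supported on ker Z, free of
charge against Z, repairs the remaining equations; it can be made positive semidefinite because the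
matrices QWQ meet the cone only in 0, so that some positive definite matrix is orthogonal to all of
them. -/

/-! ### The matrix inner product, quadratic forms and the kernel projection. -/

theorem frobInner_eq_trace (S T : Matrix (Fin n) (Fin n) ℝ) :
    frobInner S T = (S * Tᵀ).trace := by
  simp [frobInner, trace, mul_apply]

theorem frobInner_comm (S T : Matrix (Fin n) (Fin n) ℝ) : frobInner S T = frobInner T S := by
  simp [frobInner, mul_comm]

/-- The inner product of square matrices as a bilinear map. -/
def frobForm (n : ℕ) : Matrix (Fin n) (Fin n) ℝ →ₗ[ℝ] Matrix (Fin n) (Fin n) ℝ →ₗ[ℝ] ℝ :=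
  LinearMap.mk₂ ℝ frobInner
    (by intros; simp [frobInner_eq_trace, add_mul])
    (by intros; simp [frobInner_eq_trace])
    (by intros; simp [frobInner_eq_trace, mul_add])
    (by intros; simp [frobInner_eq_trace])

theorem frobForm_apply (S T : Matrix (Fin n) (Fin n) ℝ) : frobForm n S T = frobInner S T := rfl

theorem frobInner_add_left (S S' T : Matrix (Fin n) (Fin n) ℝ) :
    frobInner (S + S') T = frobInner S T + frobInner S' T := by
  simp [← frobForm_apply]

theorem frobInner_sub_left (S S' T : Matrix (Fin n) (Fin n) ℝ) :
    frobInner (S - S') T = frobInner S T - frobInner S' T := by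
  simp [← frobForm_apply]

theorem frobInner_add_right (S T T' : Matrix (Fin n) (Fin n) ℝ) :
    frobInner S (T + T') = frobInner S T + frobInner S T' := by
  simp [← frobForm_apply]

theorem frobInner_smul_right (a : ℝ) (S T : Matrix (Fin n) (Fin n) ℝ) :
    frobInner S (a • T) = a * frobInner S T := by
  simp [← frobForm_apply]

theorem frobInner_zero_left (T : Matrix (Fin n) (Fin n) ℝ) : frobInner 0 T = 0 := by
  simp [frobInner]

theorem frobInner_sum_smul_left (A : Fin m → Matrix (Fin n) (Fin n) ℝ) (x : Fin m → ℝ)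
    (T : Matrix (Fin n) (Fin n) ℝ) :
    frobInner (∑ i, x i • A i) T = ∑ i, x i * frobInner (A i) T := by
  simp [← frobForm_apply]

theorem frobInner_vecMulVec (S : Matrix (Fin n) (Fin n) ℝ) (x y : Fin n → ℝ) :
    frobInner S (vecMulVec x y) = x ⬝ᵥ (S *ᵥ y) := by
  simp [frobInner, vecMulVec_apply, dotProduct, mulVec, Finset.mul_sum]
  exact Finset.sum_congr rfl fun i _ => Finset.sum_congr rfl fun j _ => by ring

theorem frobInner_conj (S Y R : Matrix (Fin n) (Fin n) ℝ) (hR : R.IsSymm) :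
    frobInner S (R * Y * R) = frobInner (R * S * R) Y := by
  rw [frobInner_eq_trace, frobInner_eq_trace]
  simp only [transpose_mul, hR.eq, ← mul_assoc]
  rw [trace_mul_comm]
  simp only [← mul_assoc]

theorem exists_eq_conjTranspose_mul_self {Y : Matrix (Fin n) (Fin n) ℝ} (hY : Y.PosSemidef) :
    ∃ C : Matrix (Fin n) (Fin n) ℝ, Y = Cᴴ * C := by
  open scoped MatrixOrder in
  exact CStarAlgebra.nonneg_iff_eq_star_mul_self.mp hY.nonneg

/-- A positive semidefinite matrix is a sum of dyads, so that the inner product with it is a sum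
of values of quadratic forms. -/
theorem exists_frobInner_eq_sum_of_posSemidef {Y : Matrix (Fin n) (Fin n) ℝ} (hY : Y.PosSemidef) :
    ∃ C : Fin n → Fin n → ℝ, ∀ S, frobInner S Y = ∑ k, C k ⬝ᵥ (S *ᵥ C k) := by
  obtain ⟨C, rfl⟩ := exists_eq_conjTranspose_mul_self hY
  refine ⟨C, fun S => ?_⟩
  have : Cᴴ * C = ∑ k, vecMulVec (C k) (C k) := by
    ext i j
    simp [mul_apply, vecMulVec_apply, Matrix.sum_apply]
  rw [this, ← frobForm_apply, map_sum]
  exact Finset.sum_congr rfl fun k _ => frobInner_vecMulVec _ _ _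

theorem frobInner_nonneg {S Y : Matrix (Fin n) (Fin n) ℝ} (hS : S.PosSemidef)
    (hY : Y.PosSemidef) : 0 ≤ frobInner S Y := by
  obtain ⟨C, hC⟩ := exists_frobInner_eq_sum_of_posSemidef hY
  rw [hC]
  exact Finset.sum_nonneg fun k _ => by simpa using hS.dotProduct_mulVec_nonneg (C k)

theorem posSemidef_iff_real {S : Matrix (Fin n) (Fin n) ℝ} :
    S.PosSemidef ↔ S.IsSymm ∧ ∀ x, 0 ≤ x ⬝ᵥ (S *ᵥ x) := by
  rw [posSemidef_iff_dotProduct_mulVec]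
  simp [IsHermitian, IsSymm]

theorem dotProduct_mulVec_symm {S : Matrix (Fin n) (Fin n) ℝ} (hS : S.IsSymm) (x y : Fin n → ℝ) :
    x ⬝ᵥ (S *ᵥ y) = y ⬝ᵥ (S *ᵥ x) := by
  rw [dotProduct_mulVec, dotProduct_comm, ← mulVec_transpose, hS.eq]

theorem mulVec_eq_zero_of_posSemidef {S : Matrix (Fin n) (Fin n) ℝ} (hS : S.PosSemidef)
    {x : Fin n → ℝ} (hx : x ⬝ᵥ (S *ᵥ x) = 0) : S *ᵥ x = 0 :=
  (hS.dotProduct_mulVec_zero_iff x).1 (by simpa using hx)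

/-- Every linear functional agrees on symmetric matrices with the inner product with a symmetric
matrix. -/
theorem exists_symm_representation (f : Matrix (Fin n) (Fin n) ℝ →ₗ[ℝ] ℝ) :
    ∃ Y : Matrix (Fin n) (Fin n) ℝ, Y.IsSymm ∧ ∀ S, S.IsSymm → f S = frobInner S Y := by
  let G : Matrix (Fin n) (Fin n) ℝ := of fun i j => f (single i j 1)
  have hG : ∀ S, f S = frobInner S G := fun S => by
    conv_lhs => rw [matrix_eq_sum_single S]
    simp only [map_sum, frobInner]
    refine Finset.sum_congr rfl fun i _ => Finset.sum_congr rfl fun j _ => ?_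
    have : single i j (S i j) = S i j • single i j (1 : ℝ) := by simp
    rw [this, map_smul]; rfl
  refine ⟨(1 / 2 : ℝ) • (G + Gᵀ), ?_, fun S hS => ?_⟩
  · simp [IsSymm, add_comm]
  · have : frobInner S Gᵀ = frobInner S G := by
      rw [frobInner_eq_trace, frobInner_eq_trace, transpose_transpose, ← trace_transpose,
        transpose_mul, hS.eq, trace_mul_comm]
    rw [frobInner_smul_right, frobInner_add_right, this, hG]; ring

/-- The orthogonal projection `Q` onto the kernel of a symmetric matrix, together with a
generalised inverse. -/
theorem exists_kernel_projection {Z : Matrix (Fin n) (Fin n) ℝ} (hZ : Z.IsSymm) :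
    ∃ Q G : Matrix (Fin n) (Fin n) ℝ, Q.IsSymm ∧ Q * Q = Q ∧ Z * Q = 0 ∧ 1 - Q = G * Z := by
  have hH : Z.IsHermitian := by simpa [IsHermitian, IsSymm] using hZ
  let U : Matrix (Fin n) (Fin n) ℝ := hH.eigenvectorUnitary
  have hU : Uᵀ * U = 1 := by
    simpa [U, star_eq_conjTranspose] using Unitary.coe_star_mul_self hH.eigenvectorUnitary
  have hU' : U * Uᵀ = 1 := mul_eq_one_comm.1 hU
  have hs : Z = U * diagonal hH.eigenvalues * Uᵀ := by
    have := hH.spectral_theorem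
    rw [Unitary.conjStarAlgAut_apply] at this
    simpa [U, star_eq_conjTranspose] using this
  set l := hH.eigenvalues
  have key : ∀ d e : Fin n → ℝ, (U * diagonal d * Uᵀ) * (U * diagonal e * Uᵀ) =
      U * diagonal (fun i => d i * e i) * Uᵀ := fun d e => by
    calc _ = U * diagonal d * (Uᵀ * U) * diagonal e * Uᵀ := by simp only [mul_assoc]
      _ = _ := by rw [hU, mul_one, mul_assoc U, diagonal_mul_diagonal]
  -- Both are functions of Z: Q is the indicator of the eigenvalue 0, and G inverts eigenvalues,
  -- with the convention `0⁻¹ = 0` on the kernel.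
  refine ⟨U * diagonal (fun i => if l i = 0 then 1 else 0) * Uᵀ,
    U * diagonal (fun i => (l i)⁻¹) * Uᵀ, ?_, ?_, ?_, ?_⟩
  · simp [IsSymm, transpose_mul, mul_assoc]
  · rw [key]; congr 3; ext i; split_ifs <;> simp
  · rw [hs, key]
    have : (fun i => l i * if l i = 0 then (1 : ℝ) else 0) = 0 := by
      ext i; by_cases h : l i = 0 <;> simp [h]
    rw [this]; simp
  · rw [hs, key]
    have h1 : (1 : Matrix (Fin n) (Fin n) ℝ) = U * diagonal (fun _ => 1) * Uᵀ := by
      rw [diagonal_one, mul_one, hU']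
    rw [h1, ← sub_mul, ← mul_sub, diagonal_sub]
    congr 3
    ext i
    by_cases h : l i = 0 <;> simp [h]

/-! ### Slacks and their kernels. -/

theorem isSymm_sum_smul {A : Fin m → Matrix (Fin n) (Fin n) ℝ} (hA : ∀ i, (A i).IsSymm)
    (x : Fin m → ℝ) : (∑ i, x i • A i).IsSymm := by
  simp [IsSymm, transpose_sum, transpose_smul, fun i => (hA i).eq]

theorem IsSlack.posSemidef {A : Fin m → Matrix (Fin n) (Fin n) ℝ} {B S : Matrix (Fin n) (Fin n) ℝ}
    (hS : IsSlack A B S) : S.PosSemidef := by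
  obtain ⟨x, hx, rfl⟩ := hS
  exact hx

theorem IsSlack.midpoint {A : Fin m → Matrix (Fin n) (Fin n) ℝ}
    {B S S' : Matrix (Fin n) (Fin n) ℝ} (hS : IsSlack A B S) (hS' : IsSlack A B S') :
    IsSlack A B ((1 / 2 : ℝ) • (S + S')) := by
  have hp := hS.posSemidef
  have hp' := hS'.posSemidef
  obtain ⟨x, hx, h⟩ := hS
  obtain ⟨y, hy, h'⟩ := hS'
  have key : (1 / 2 : ℝ) • (S + S') = B - ∑ i, ((1 / 2 : ℝ) • (x + y)) i • A i := by
    simp only [h, h', Pi.smul_apply, Pi.add_apply, smul_eq_mul, mul_smul, add_smul,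
      ← Finset.smul_sum, Finset.sum_add_distrib]
    module
  refine ⟨_, ?_, key⟩
  show PosSemidef _
  rw [← key]
  exact (hp.add hp').smul (by norm_num)

/-- The kernel of a slack of maximum rank lies in the kernel of every slack. -/
theorem IsMaxRankSlack.mulVec_eq_zero {A : Fin m → Matrix (Fin n) (Fin n) ℝ}
    {B Z S : Matrix (Fin n) (Fin n) ℝ} (hZ : IsMaxRankSlack A B Z) (hS : IsSlack A B S)
    {w : Fin n → ℝ} (hw : Z *ᵥ w = 0) : S *ᵥ w = 0 := by
  have hM := hZ.1.midpoint hS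
  set M := (1 / 2 : ℝ) • (Z + S) with hMdef
  -- For a sum of nonnegative forms to vanish both must vanish, so the midpoint kills only ker Z ∩
  -- ker S. Its rank is at most that of Z, so its kernel is all of ker Z.
  have hle : LinearMap.ker M.mulVecLin ≤ LinearMap.ker (Z.mulVecLin) ⊓ LinearMap.ker S.mulVecLin := by
    intro v hv
    have hv : M *ᵥ v = 0 := by simpa using hv
    have hq : v ⬝ᵥ (Z *ᵥ v) + v ⬝ᵥ (S *ᵥ v) = 0 := by
      have : v ⬝ᵥ (M *ᵥ v) = 0 := by rw [hv, dotProduct_zero]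
      rw [hMdef, smul_mulVec, dotProduct_smul, add_mulVec, dotProduct_add] at this
      simpa using this
    have h1 := (posSemidef_iff_real.1 hZ.1.posSemidef).2 v
    have h2 := (posSemidef_iff_real.1 hS.posSemidef).2 v
    exact ⟨by simpa using mulVec_eq_zero_of_posSemidef hZ.1.posSemidef (by linarith),
      by simpa using mulVec_eq_zero_of_posSemidef hS.posSemidef (by linarith)⟩
  have hrank := hZ.2 M hM
  have e1 := LinearMap.finrank_range_add_finrank_ker M.mulVecLin
  have e2 := LinearMap.finrank_range_add_finrank_ker Z.mulVecLin
  have heq := Submodule.eq_of_le_of_finrank_le (hle.trans inf_le_left) (by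
    unfold Matrix.rank at hrank
    omega)
  have : w ∈ LinearMap.ker M.mulVecLin := by
    rw [heq]; simpa using hw
  simpa using (hle this).2

/-! ### A critical direction forces bad behaviour. -/

/-- There is a combination `V` of the `A i` that is nonnegative on the kernel of `Z`, and a zero
`w` of its quadratic form in that kernel which is not in the kernel of `V`. -/
def HasCriticalDirection (A : Fin m → Matrix (Fin n) (Fin n) ℝ) (Z : Matrix (Fin n) (Fin n) ℝ) :
    Prop :=
  ∃ (y : Fin m → ℝ) (w : Fin n → ℝ), Z *ᵥ w = 0 ∧
    (∀ k, Z *ᵥ k = 0 → 0 ≤ k ⬝ᵥ ((∑ i, y i • A i) *ᵥ k)) ∧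
    w ⬝ᵥ ((∑ i, y i • A i) *ᵥ w) = 0 ∧ (∑ i, y i • A i) *ᵥ w ≠ 0

theorem dotProduct_sum_smul_mulVec (A : Fin m → Matrix (Fin n) (Fin n) ℝ) (x : Fin m → ℝ)
    (p w : Fin n → ℝ) : p ⬝ᵥ ((∑ i, x i • A i) *ᵥ w) = ∑ i, x i * (p ⬝ᵥ (A i *ᵥ w)) := by
  simp_rw [← frobInner_vecMulVec, frobInner_sum_smul_left]

theorem HasCriticalDirection.badlyBehaved {A : Fin m → Matrix (Fin n) (Fin n) ℝ}
    {B Z : Matrix (Fin n) (Fin n) ℝ} (hZ : IsMaxRankSlack A B Z)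
    (h : HasCriticalDirection A Z) : BadlyBehaved A B := by
  obtain ⟨y, w, hw, hnn, -, hne⟩ := h
  intro hwell
  set p := (∑ i, y i • A i) *ᵥ w with hp
  have hval : ∀ x ∈ feasibleSet A B,
      ∑ i, -(p ⬝ᵥ (A i *ᵥ w)) * x i = -(p ⬝ᵥ (B *ᵥ w)) := fun x hx => by
    have h0 := hZ.mulVec_eq_zero ⟨x, hx, rfl⟩ hw
    rw [sub_mulVec, sub_eq_zero] at h0
    rw [h0, dotProduct_sum_smul_mulVec, ← Finset.sum_neg_distrib]
    exact Finset.sum_congr rfl fun i _ => by ring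
  obtain ⟨x₀, hx₀, hZx⟩ := hZ.1
  have himg : (fun x : Fin m → ℝ => ∑ i, -(p ⬝ᵥ (A i *ᵥ w)) * x i) '' feasibleSet A B =
      {-(p ⬝ᵥ (B *ᵥ w))} := by
    refine Set.Subset.antisymm ?_ ?_
    · rintro _ ⟨x, hx, rfl⟩
      exact hval x hx
    · rintro _ rfl
      exact ⟨x₀, hx₀, hval x₀ hx₀⟩
  obtain ⟨Y, ⟨hY, hAY⟩, hBY⟩ := hwell (fun i => -(p ⬝ᵥ (A i *ᵥ w))) (-(p ⬝ᵥ (B *ᵥ w)))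
    (by rw [himg]; exact isLUB_singleton)
  -- Complementary slackness: Y has no duality gap, so the dyads composing it come from ker Z.
  have hZY : frobInner Z Y = 0 := by
    rw [hZx, frobInner_sub_left, frobInner_sum_smul_left, hBY, ← hval x₀ hx₀, sub_eq_zero]
    exact Finset.sum_congr rfl fun i _ => by rw [hAY]; ring
  obtain ⟨C, hC⟩ := exists_frobInner_eq_sum_of_posSemidef hY
  have hZp := hZ.1.posSemidef
  have hCk : ∀ k, Z *ᵥ C k = 0 := fun k => by
    rw [hC, Finset.sum_eq_zero_iff_of_nonneg
      fun k _ => (posSemidef_iff_real.1 hZp).2 (C k)] at hZY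
    exact mulVec_eq_zero_of_posSemidef hZp (hZY k (Finset.mem_univ k))
  have hpos : 0 ≤ frobInner (∑ i, y i • A i) Y := by
    rw [hC]
    exact Finset.sum_nonneg fun k _ => hnn _ (hCk k)
  have hneg : frobInner (∑ i, y i • A i) Y = -(p ⬝ᵥ p) := by
    rw [frobInner_sum_smul_left]
    nth_rewrite 2 [hp]
    rw [dotProduct_sum_smul_mulVec, ← Finset.sum_neg_distrib]
    exact Finset.sum_congr rfl fun i _ => by rw [hAY]; ring
  have : p ⬝ᵥ p = 0 := le_antisymm (by linarith) (by
    simpa using dotProduct_star_self_nonneg p)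
  exact hne (dotProduct_self_eq_zero.1 this)

/-! ### From the normal form to a critical direction. -/

theorem rotate_quad (T M : Matrix (Fin n) (Fin n) ℝ) (x y : Fin n → ℝ) :
    x ⬝ᵥ (rotate T M *ᵥ y) = (T *ᵥ x) ⬝ᵥ (M *ᵥ (T *ᵥ y)) := by
  rw [rotate, ← mulVec_mulVec, ← mulVec_mulVec, dotProduct_mulVec x, vecMul_transpose]

theorem rotate_sum_smul (A : Fin m → Matrix (Fin n) (Fin n) ℝ) (x : Fin m → ℝ)
    (T : Matrix (Fin n) (Fin n) ℝ) : rotate T (∑ i, x i • A i) = ∑ i, x i • rotate T (A i) := by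
  simp [rotate, Finset.mul_sum, Finset.sum_mul]

theorem quad_nonneg_of_submatrix_posSemidef {V : Matrix (Fin n) (Fin n) ℝ} {r : ℕ}
    (hV : (V.submatrix (fun i : {i : Fin n // r < (i : ℕ)} => (i : Fin n))
      (fun j : {j : Fin n // r < (j : ℕ)} => (j : Fin n))).PosSemidef)
    {x : Fin n → ℝ} (hx : ∀ i : Fin n, (i : ℕ) ≤ r → x i = 0) : 0 ≤ x ⬝ᵥ (V *ᵥ x) := by
  have hsum : ∀ f : Fin n → ℝ, (∀ i : Fin n, (i : ℕ) ≤ r → f i = 0) →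
      ∑ i : {i : Fin n // r < (i : ℕ)}, f i = ∑ i, f i := fun f hf => by
    rw [← Fintype.sum_subtype_add_sum_subtype (fun i : Fin n => r < (i : ℕ)) f, left_eq_add]
    exact Finset.sum_eq_zero fun i _ => hf i (not_lt.1 i.2)
  have h := hV.dotProduct_mulVec_nonneg (fun i => x i)
  simp only [dotProduct, mulVec, Pi.star_apply, star_trivial, submatrix_apply] at h ⊢
  rw [hsum (fun i => x i * ∑ j : {i : Fin n // r < (i : ℕ)}, V i j * x j)
    fun i hi => by rw [hx i hi, zero_mul]] at h
  refine h.trans_eq (Finset.sum_congr rfl fun i _ => ?_)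
  rw [hsum (fun j => V i j * x j) fun j hj => by rw [hx j hj, mul_zero]]

/-- Column r of V is supported on index 0, which is below r because 1 ≤ r. So coordinate r
contributes nothing to the form on these vectors, and only the block V₃₃ is left. -/
theorem HasBadForm.quad_nonneg {V : Matrix (Fin n) (Fin n) ℝ} {r : ℕ} (hV : HasBadForm r V)
    {x : Fin n → ℝ} (hx : ∀ i : Fin n, (i : ℕ) < r → x i = 0) : 0 ≤ x ⬝ᵥ (V *ᵥ x) := by
  obtain ⟨hsymm, hr, ⟨k, hk, hcol⟩, hpsd⟩ := hV
  have hcross : ∀ z : Fin n → ℝ, (∀ i : Fin n, (i : ℕ) < r → z i = 0) →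
      z ⬝ᵥ (V *ᵥ Pi.single k 1) = 0 := fun z hz => by
    rw [mulVec_single_one]
    refine Finset.sum_eq_zero fun i _ => ?_
    rw [col_apply, hcol]
    split_ifs with h
    · rw [hz i (by omega), zero_mul]
    · rw [mul_zero]
  set x' := x - x k • Pi.single k 1 with hx'
  have hxx : x = x' + x k • Pi.single k 1 := by simp [hx']
  have hx0 : ∀ i : Fin n, (i : ℕ) ≤ r → x' i = 0 := fun i hi => by
    rcases hi.lt_or_eq with h | h
    · have : i ≠ k := by rintro rfl; omega
      simp [hx', hx i h, this]
    · obtain rfl : i = k := Fin.ext (by omega)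
      simp [hx']
  have key : x ⬝ᵥ (V *ᵥ x) = x' ⬝ᵥ (V *ᵥ x') := by
    have hsplit : ∀ z : Fin n → ℝ, (∀ i : Fin n, (i : ℕ) < r → z i = 0) →
        z ⬝ᵥ (V *ᵥ x) = z ⬝ᵥ (V *ᵥ x') := fun z hz => by
      rw [hx', mulVec_sub, dotProduct_sub, mulVec_smul, dotProduct_smul, hcross z hz]
      simp
    rw [hsplit x hx, dotProduct_mulVec_symm hsymm, hsplit x' fun i hi => hx0 i hi.le]
  rw [key]
  exact quad_nonneg_of_submatrix_posSemidef hpsd hx0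

/-- The critical vector is column r of T. Since B is Z plus a combination of the A_i, a multiple of
B in V only adds a multiple of Z, which is invisible on ker Z. -/
theorem hasCriticalDirection_of_hasBadForm {A : Fin m → Matrix (Fin n) (Fin n) ℝ}
    {B Z : Matrix (Fin n) (Fin n) ℝ} (hZ : IsSlack A B Z) {T V : Matrix (Fin n) (Fin n) ℝ} {r : ℕ}
    (hT : IsUnit T) (hTZ : rotate T Z = idZero n r)
    (hV : IsLinComb (fun i => rotate T (A i)) (rotate T B) V) (hbad : HasBadForm r V) :
    HasCriticalDirection A Z := by
  obtain ⟨v, v₀, hVv⟩ := hV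
  have hZp := hZ.posSemidef
  obtain ⟨x₀, -, hx₀⟩ := hZ
  set W := ∑ i, (v + v₀ • x₀) i • A i with hW
  have hVW : V = rotate T (W + v₀ • Z) := by
    have : W + v₀ • Z = ∑ i, v i • A i + v₀ • B := by
      simp only [hW, hx₀, Pi.add_apply, Pi.smul_apply, smul_eq_mul, add_smul, mul_smul,
        Finset.sum_add_distrib, ← Finset.smul_sum]
      module
    rw [this, hVv, ← rotate_sum_smul]
    simp [rotate, mul_add, add_mul]
  have hWV : ∀ x y : Fin n → ℝ, Z *ᵥ (T *ᵥ y) = 0 →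
      (T *ᵥ x) ⬝ᵥ (W *ᵥ (T *ᵥ y)) = x ⬝ᵥ (V *ᵥ y) := fun x y hy => by
    rw [hVW, rotate_quad, add_mulVec, smul_mulVec, hy]; simp
  have hnn : ∀ x : Fin n → ℝ, (∀ i : Fin n, (i : ℕ) < r → x i = 0) → 0 ≤ x ⬝ᵥ (V *ᵥ x) :=
    fun x => hbad.quad_nonneg
  obtain ⟨-, hr, ⟨k, hk, hcol⟩, -⟩ := hbad
  have hVk : ∀ i : Fin n, Pi.single i 1 ⬝ᵥ (V *ᵥ Pi.single k 1) = if (i : ℕ) = 0 then 1 else 0 :=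
    fun i => by rw [mulVec_single_one, single_one_dotProduct, col_apply, hcol]
  have hw : Z *ᵥ (T *ᵥ Pi.single k 1) = 0 := by
    refine mulVec_eq_zero_of_posSemidef hZp ?_
    rw [← rotate_quad, hTZ, mulVec_single_one, single_one_dotProduct, col_apply, idZero]
    simp [hk]
  refine ⟨v + v₀ • x₀, T *ᵥ Pi.single k 1, hw, fun b hb => ?_, ?_, fun h0 => ?_⟩
  · obtain ⟨a, rfl⟩ := (mulVec_surjective_iff_isUnit.2 hT) b
    rw [← hW, hWV _ _ hb]
    refine hnn a fun i hi => ?_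
    have h0 : Pi.single i 1 ⬝ᵥ (rotate T Z *ᵥ a) = 0 := by rw [rotate_quad, hb, dotProduct_zero]
    rw [hTZ, single_one_dotProduct, idZero, mulVec_diagonal] at h0
    simpa [hi] using h0
  · rw [← hW, hWV _ _ hw, hVk, if_neg (by omega)]
  · have := hWV (Pi.single ⟨0, by have := k.2; omega⟩ 1) _ hw
    rw [← hW] at h0
    rw [h0, hVk] at this
    simp at this

/-! ### From a critical direction to the normal form. -/

/-- An orthonormal basis whose last vectors lie in a given subspace and the others in its
orthogonal complement, with one vector prescribed in each of the two. -/
theorem exists_adapted_orthonormalBasis {E : Type*} [NormedAddCommGroup E]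
    [InnerProductSpace ℝ E] [FiniteDimensional ℝ E] (hE : Module.finrank ℝ E = n)
    (K : Submodule ℝ E) {r : ℕ} (hr : 1 ≤ r) (hK : Module.finrank ℝ K + r = n) {w p : E}
    (hw : w ∈ K) (hw1 : ‖w‖ = 1) (hp : p ∈ Kᗮ) (hp1 : ‖p‖ = 1) (k : Fin n) (hk : (k : ℕ) = r) :
    ∃ b : OrthonormalBasis (Fin n) ℝ E, b k = w ∧ (∀ i : Fin n, (i : ℕ) = 0 → b i = p) ∧
      (∀ i : Fin n, r ≤ (i : ℕ) → b i ∈ K) ∧ ∀ i : Fin n, (i : ℕ) < r → b i ∈ Kᗮ := by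
  have hcard : Fintype.card {i : Fin n // r ≤ (i : ℕ)} = n - r := by
    have h1 := Fintype.card_subtype_compl (fun i : Fin n => (i : ℕ) < r)
    simp only [not_lt] at h1
    rw [h1, Fintype.card_fin, Fintype.card_subtype]
    simp only [Fin.card_filter_val_lt]
    omega
  obtain ⟨c, hc⟩ := Orthonormal.exists_orthonormalBasis_extension_of_card_eq (𝕜 := ℝ) (E := K)
    (ι := {i : Fin n // r ≤ (i : ℕ)}) (by omega) (v := fun _ => ⟨w, hw⟩) (s := {⟨k, hk.ge⟩})
    ⟨fun i => by simpa using hw1, fun i j hij => absurd (Subsingleton.elim i j) hij⟩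
  -- The value p matters only at index 0: indices strictly between 0 and r lie outside the
  -- prescribed set and are filled in by the extension.
  let v : Fin n → E := fun i => if h : r ≤ (i : ℕ) then c ⟨i, h⟩ else p
  have hvK : ∀ i : Fin n, ∀ h : r ≤ (i : ℕ), v i = c ⟨i, h⟩ := fun i h => dif_pos h
  have hvp : ∀ i : Fin n, ¬ r ≤ (i : ℕ) → v i = p := fun i h => dif_neg h
  have hcp : ∀ j, inner ℝ ((c j : K) : E) p = 0 := fun j => hp _ (c j).2
  have hco := orthonormal_iff_ite.1 c.orthonormal
  obtain ⟨b, hb⟩ := Orthonormal.exists_orthonormalBasis_extension_of_card_eq (𝕜 := ℝ) (E := E)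
    (ι := Fin n) (by simpa using hE) (v := v) (s := {i | r ≤ (i : ℕ) ∨ (i : ℕ) = 0}) (by
      refine ⟨?_, ?_⟩
      · rintro ⟨i, hi⟩
        by_cases h : r ≤ (i : ℕ)
        · exact (congrArg norm (hvK i h)).trans (c.orthonormal.1 ⟨i, h⟩)
        · exact (congrArg norm (hvp i h)).trans hp1
      · rintro ⟨i, hi⟩ ⟨j, hj⟩ hij
        have hij' : i ≠ j := fun h => hij (Subtype.ext h)
        show inner ℝ (v i) (v j) = 0
        by_cases h : r ≤ (i : ℕ) <;> by_cases h' : r ≤ (j : ℕ)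
        · rw [hvK i h, hvK j h']
          exact c.orthonormal.2 (fun e => hij' (congrArg Subtype.val e))
        · rw [hvK i h, hvp j h', hcp]
        · rw [hvK j h', hvp i h, real_inner_comm, hcp]
        · exact absurd (Fin.ext ((hi.resolve_left h).trans (hj.resolve_left h').symm)) hij')
  have hbK : ∀ i : Fin n, ∀ h : r ≤ (i : ℕ), b i = c ⟨i, h⟩ := fun i h => by
    rw [hb i (Or.inl h), hvK i h]
  refine ⟨b, ?_, fun i hi => ?_, fun i hi => ?_, fun i hi => ?_⟩
  · rw [hbK k hk.ge, hc _ rfl]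
  · rw [hb i (Or.inr hi), hvp i (by omega)]
  · rw [hbK i hi]; exact (c _).2
  · intro z hz
    have hz' : z = ∑ j, c.repr ⟨z, hz⟩ j • ((c j : K) : E) := by
      have := congrArg (Subtype.val) (c.sum_repr ⟨z, hz⟩)
      simpa using this.symm
    rw [hz', sum_inner]
    refine Finset.sum_eq_zero fun j _ => ?_
    rw [inner_smul_left, ← hbK j.1 j.2, b.orthonormal.2, mul_zero]
    intro e
    have := j.2
    rw [e] at this
    omega

/-- Where Z vanishes Q is the identity, so the two forms have no common zero. The sum serves both as
an inner product adapted to ker Z and as a Slater point. -/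
theorem posDef_add_kernel_projection {Z Q : Matrix (Fin n) (Fin n) ℝ} (hZ : Z.PosSemidef)
    (hQ : Q.IsSymm) (hQQ : Q * Q = Q) {G : Matrix (Fin n) (Fin n) ℝ} (hG : 1 - Q = G * Z) :
    (Z + Q).PosDef := by
  have hQp : Q.PosSemidef := by
    rw [← hQQ]
    nth_rewrite 1 [← hQ.eq]
    exact posSemidef_conjTranspose_mul_self Q
  have hs := hZ.add hQp
  refine PosDef.of_dotProduct_mulVec_pos hs.1 fun x hx => ?_
  rw [star_trivial]
  refine ((posSemidef_iff_real.1 hs).2 x).lt_of_ne fun h0 => hx ?_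
  have h1 := (posSemidef_iff_real.1 hZ).2 x
  have h2 := (posSemidef_iff_real.1 hQp).2 x
  rw [add_mulVec, dotProduct_add] at h0
  have e1 := mulVec_eq_zero_of_posSemidef hZ (x := x) (by linarith)
  have e2 := mulVec_eq_zero_of_posSemidef hQp (x := x) (by linarith)
  have : (1 - Q) *ᵥ x = G *ᵥ (Z *ᵥ x) := by rw [hG, mulVec_mulVec]
  rw [sub_mulVec, one_mulVec, e1, e2] at this
  simpa using this

theorem compress_posSemidef {W Z Q : Matrix (Fin n) (Fin n) ℝ} (hW : W.IsSymm) (hQ : Q.IsSymm)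
    (hZQ : Z * Q = 0) (hnn : ∀ k, Z *ᵥ k = 0 → 0 ≤ k ⬝ᵥ (W *ᵥ k)) : (Q * W * Q).PosSemidef := by
  refine posSemidef_iff_real.2 ⟨?_, fun x => ?_⟩
  · simp [IsSymm, hQ.eq, hW.eq, mul_assoc]
  · have := rotate_quad Q W x x
    rw [rotate, hQ.eq] at this
    rw [this]
    exact hnn _ (by rw [mulVec_mulVec, hZQ, zero_mulVec])

theorem mulVec_kernel_projection {Z Q G : Matrix (Fin n) (Fin n) ℝ} (hG : 1 - Q = G * Z)
    {x : Fin n → ℝ} (hx : Z *ᵥ x = 0) : Q *ᵥ x = x := by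
  have : (1 - Q) *ᵥ x = G *ᵥ (Z *ᵥ x) := by rw [hG, mulVec_mulVec]
  rw [sub_mulVec, one_mulVec, hx, mulVec_zero, sub_eq_zero] at this
  exact this.symm

/-- A positive definite matrix is the Gram matrix of a linear isomorphism to Euclidean space. -/
theorem exists_equiv_inner_eq {H : Matrix (Fin n) (Fin n) ℝ} (hH : H.PosDef) :
    ∃ e : (Fin n → ℝ) ≃ₗ[ℝ] EuclideanSpace ℝ (Fin n),
      ∀ x y, inner ℝ (e x) (e y) = x ⬝ᵥ (H *ᵥ y) := by
  obtain ⟨C, hC⟩ := exists_eq_conjTranspose_mul_self hH.posSemidef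
  let e : (Fin n → ℝ) →ₗ[ℝ] EuclideanSpace ℝ (Fin n) :=
    (WithLp.linearEquiv 2 ℝ (Fin n → ℝ)).symm.toLinearMap ∘ₗ C.mulVecLin
  have he : ∀ x y, inner ℝ (e x) (e y) = x ⬝ᵥ (H *ᵥ y) := fun x y => by
    rw [EuclideanSpace.inner_eq_star_dotProduct, hC, ← mulVec_mulVec, dotProduct_mulVec x,
      conjTranspose_eq_transpose_of_trivial, vecMul_transpose, dotProduct_comm]
    simp [e]
  have hinj : Function.Injective e := by
    rw [injective_iff_map_eq_zero]
    intro x hx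
    by_contra h
    have := hH.dotProduct_mulVec_pos h
    rw [star_trivial, ← he, hx, inner_zero_left] at this
    exact lt_irrefl _ this
  exact ⟨LinearEquiv.ofInjectiveOfFinrankEq e hinj (by simp), fun x y => he x y⟩

/-- In the inner product H = Z + Q, an orthonormal basis adapted to ker Z and its complement brings
Z to I_r ⊕ 0. Since Ww = Zp = Hp with p orthogonal to ker Z, taking w and p as basis directions
makes the column of W at w a multiple of e₁. -/
theorem HasCriticalDirection.exists_hasBadForm {A : Fin m → Matrix (Fin n) (Fin n) ℝ}
    (B : Matrix (Fin n) (Fin n) ℝ) {Z : Matrix (Fin n) (Fin n) ℝ} (hA : ∀ i, (A i).IsSymm)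
    (hZ : Z.PosSemidef) (h : HasCriticalDirection A Z) :
    ∃ T : Matrix (Fin n) (Fin n) ℝ, IsUnit T ∧ rotate T Z = idZero n Z.rank ∧
      ∃ V, IsLinComb (fun i => rotate T (A i)) (rotate T B) V ∧ HasBadForm Z.rank V := by
  obtain ⟨y, w, hw, hnn, hww, hne⟩ := h
  have hZs := (posSemidef_iff_real.1 hZ).1
  have hW := isSymm_sum_smul hA y
  set W := ∑ i, y i • A i with hWdef
  obtain ⟨Q, G, hQ, hQQ, hZQ, hG⟩ := exists_kernel_projection hZs
  have hH := posDef_add_kernel_projection hZ hQ hQQ hG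
  obtain ⟨e, he⟩ := exists_equiv_inner_eq hH
  have hQWQ := compress_posSemidef hW hQ hZQ hnn
  have hQw := mulVec_kernel_projection hG hw
  have hconj : ∀ x z, x ⬝ᵥ ((Q * W * Q) *ᵥ z) = (Q *ᵥ x) ⬝ᵥ (W *ᵥ (Q *ᵥ z)) := fun x z => by
    have := rotate_quad Q W x z
    rwa [rotate, hQ.eq] at this
  set u := W *ᵥ w with hu
  -- A zero of the semidefinite form QWQ is in its kernel, so Ww is orthogonal to ker Z and hence in
  -- the range of Z.
  have hQu : Q *ᵥ u = 0 := by
    have := mulVec_eq_zero_of_posSemidef hQWQ (x := w) (by rw [hconj, hQw, hww])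
    rwa [← mulVec_mulVec, hQw, ← mulVec_mulVec] at this
  have hGt : 1 - Q = Z * Gᵀ := by
    have := congrArg transpose hG
    simpa [hQ.eq, hZs.eq] using this
  set p := (1 - Q) *ᵥ (Gᵀ *ᵥ u) with hpdef
  have hZp : Z *ᵥ p = u := by
    rw [hpdef, mulVec_mulVec, mul_sub, mul_one, hZQ, sub_zero, mulVec_mulVec, ← hGt, sub_mulVec,
      hQu, one_mulVec, sub_zero]
  have hQp : Q *ᵥ p = 0 := by
    rw [hpdef, mulVec_mulVec, mul_sub, mul_one, hQQ, sub_self, zero_mulVec]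
  have hp0 : p ≠ 0 := fun h => hne (by rw [← hZp, h, mulVec_zero])
  have hw0 : w ≠ 0 := fun h => hne (by rw [hu, h, mulVec_zero])
  have hHQ : (Z + Q) * Q = Q := by rw [add_mul, hZQ, hQQ, zero_add]
  set K := (LinearMap.ker Z.mulVecLin).map e.toLinearMap with hKdef
  have hmemK : ∀ x, e x ∈ K ↔ Z *ᵥ x = 0 := fun x => by
    rw [hKdef]
    simp
  have hKp : e p ∈ Kᗮ := by
    intro z hz
    obtain ⟨x, rfl⟩ := e.surjective z
    rw [he, add_mulVec, hQp, add_zero, dotProduct_mulVec_symm hZs, (hmemK x).1 hz,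
      dotProduct_zero]
  have hrk : Module.finrank ℝ K + Z.rank = n := by
    have h1 := LinearMap.finrank_range_add_finrank_ker Z.mulVecLin
    rw [hKdef, LinearEquiv.finrank_map_eq, Matrix.rank]
    simp at h1
    omega
  have hr : 1 ≤ Z.rank := by
    refine Nat.one_le_iff_ne_zero.2 fun h => hne ?_
    rw [Matrix.rank, Submodule.finrank_eq_zero, LinearMap.range_eq_bot] at h
    rw [← hZp, ← mulVecLin_apply, h, LinearMap.zero_apply]
  have hrn : Z.rank < n := by
    have : 0 < Module.finrank ℝ K := Module.finrank_pos_iff_exists_ne_zero.2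
      ⟨⟨e w, (hmemK w).2 hw⟩, fun h => hw0 (by simpa using h)⟩
    omega
  have hnp : 0 < ‖e p‖ := norm_pos_iff.2 (by simpa using hp0)
  have hnw : 0 < ‖e w‖ := norm_pos_iff.2 (by simpa using hw0)
  obtain ⟨b, hbk, hb0, hbK, hbKp⟩ := exists_adapted_orthonormalBasis (by simp) K hr hrk
    (w := ‖e w‖⁻¹ • e w) (p := ‖e p‖⁻¹ • e p) (K.smul_mem _ ((hmemK w).2 hw))
    (by rw [norm_smul, norm_inv, norm_norm, inv_mul_cancel₀ hnw.ne'])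
    (Kᗮ.smul_mem _ hKp) (by rw [norm_smul, norm_inv, norm_norm, inv_mul_cancel₀ hnp.ne'])
    ⟨Z.rank, hrn⟩ rfl
  let T : Matrix (Fin n) (Fin n) ℝ := of fun a i => e.symm (b i) a
  have hT : ∀ i, T *ᵥ Pi.single i 1 = e.symm (b i) := fun i => by
    rw [mulVec_single_one]; rfl
  have hrot : ∀ M i j, rotate T M i j = e.symm (b i) ⬝ᵥ (M *ᵥ e.symm (b j)) := fun M i j => by
    rw [← hT, ← hT, ← rotate_quad, mulVec_single_one, single_one_dotProduct, col_apply]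
  have hker : ∀ i : Fin n, Z.rank ≤ (i : ℕ) → Z *ᵥ e.symm (b i) = 0 := fun i hi => by
    rw [← hmemK, LinearEquiv.apply_symm_apply]; exact hbK i hi
  have hbo := orthonormal_iff_ite.1 b.orthonormal
  have hrotH : ∀ i j, rotate T (Z + Q) i j = if i = j then 1 else 0 := fun i j => by
    rw [hrot, ← he, LinearEquiv.apply_symm_apply, LinearEquiv.apply_symm_apply, hbo]
  -- The scalar undoes the normalisation of w and p, so that the entry of e₁ is exactly 1.
  refine ⟨T, ?_, ?_, (‖e w‖ * ‖e p‖⁻¹) • rotate T W, ?_, ?_, hr,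
    ⟨⟨Z.rank, hrn⟩, rfl, fun i => ?_⟩, ?_⟩
  · refine IsUnit.of_mul_eq_one_right (Tᵀ * (Z + Q)) ?_
    ext i j
    exact (hrotH i j).trans (one_apply).symm
  · ext i j
    rw [idZero, diagonal_apply]
    by_cases hj : Z.rank ≤ (j : ℕ)
    · rw [hrot, hker j hj, dotProduct_zero]
      split_ifs with h1 h2
      · subst h1; omega
      · rfl
      · rfl
    by_cases hi : Z.rank ≤ (i : ℕ)
    · rw [hrot, dotProduct_mulVec_symm hZs, hker i hi, dotProduct_zero, if_neg]
      rintro rfl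
      exact hj hi
    rw [if_pos (not_le.1 hi), ← hrotH, hrot, hrot, add_mulVec, dotProduct_add, left_eq_add]
    -- As HQ = Q, the form of Q pairs b i with a vector of K in the inner product H; for i below r
    -- this is 0, so Z and H agree here.
    have h1 : e (Q *ᵥ e.symm (b j)) ∈ K := (hmemK _).2 (by rw [mulVec_mulVec, hZQ, zero_mulVec])
    have h2 := hbKp i (not_le.1 hi) _ h1
    rwa [real_inner_comm, ← e.apply_symm_apply (b i), he, mulVec_mulVec,
      hHQ] at h2
  · refine ⟨(‖e w‖ * ‖e p‖⁻¹) • y, 0, ?_⟩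
    rw [zero_smul, add_zero, ← rotate_sum_smul]
    simp [hWdef, mul_smul, ← Finset.smul_sum, rotate]
  · simp [IsSymm, rotate, transpose_mul, hW.eq, mul_assoc]
  · have h0 : (0 : ℕ) < n := by omega
    have hWk : W *ᵥ e.symm (b ⟨Z.rank, hrn⟩) = (‖e w‖⁻¹ * ‖e p‖) • ((Z + Q) *ᵥ e.symm (b ⟨0, h0⟩)) := by
      rw [hbk, hb0 _ rfl, map_smul, map_smul, e.symm_apply_apply, e.symm_apply_apply, mulVec_smul,
        ← hu, mulVec_smul, add_mulVec, hQp, add_zero, hZp, smul_smul, mul_assoc,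
        mul_inv_cancel₀ hnp.ne', mul_one]
    rw [Matrix.smul_apply, hrot, hWk, dotProduct_smul, ← hrot, hrotH]
    have h1 : ‖e w‖ * ‖e p‖⁻¹ * (‖e w‖⁻¹ * ‖e p‖) = 1 := by field_simp
    rw [smul_smul, h1]
    simp [Fin.ext_iff]
  -- Q fixes the last basis vectors, so replacing W by QWQ does not change this block.
  · have hps : ((‖e w‖ * ‖e p‖⁻¹) • rotate T (Q * W * Q)).PosSemidef :=
      (hQWQ.conjTranspose_mul_mul_same T).smul (by positivity)
    convert hps.submatrix (fun i : {i : Fin n // Z.rank < (i : ℕ)} => (i : Fin n)) using 1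
    ext i j
    simp only [submatrix_apply, Matrix.smul_apply]
    rw [hrot, hrot, hconj, mulVec_kernel_projection hG (hker i i.2.le),
      mulVec_kernel_projection hG (hker j j.2.le)]

/-! ### Compactness and Finsler's lemma. -/

/-- Only points with g ≤ 0 matter. They form a compact set on which f has a positive minimum, while
g is bounded below, so the minimum divided by a bound for -g works. -/
theorem exists_pos_forall_add_mul_nonneg {X : Type*} [TopologicalSpace X] {D : Set X}
    (hD : IsCompact D) {f g : X → ℝ} (hf : Continuous f) (hg : Continuous g)
    (hf0 : ∀ y ∈ D, 0 ≤ f y) (hfg : ∀ y ∈ D, f y = 0 → 0 < g y) :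
    ∃ ε : ℝ, 0 < ε ∧ ∀ y ∈ D, 0 ≤ f y + ε * g y := by
  have hD' : IsCompact (D ∩ {y | g y ≤ 0}) :=
    hD.inter_right (isClosed_le hg continuous_const)
  rcases (D ∩ {y | g y ≤ 0}).eq_empty_or_nonempty with h | h
  · refine ⟨1, one_pos, fun y hy => ?_⟩
    have : ¬ g y ≤ 0 := fun hgy => Set.eq_empty_iff_forall_notMem.1 h y ⟨hy, hgy⟩
    have := hf0 y hy
    linarith
  obtain ⟨y₀, ⟨hy₀, hgy₀⟩, hmin⟩ := hD'.exists_isMinOn h hf.continuousOn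
  obtain ⟨C, hC⟩ := hD.bddBelow_image hg.continuousOn
  have hpos : 0 < f y₀ := (hf0 y₀ hy₀).lt_of_ne fun h0 => hgy₀.not_gt (hfg y₀ hy₀ h0.symm)
  refine ⟨f y₀ / (|C| + 1), by positivity, fun y hy => ?_⟩
  by_cases hgy : g y ≤ 0
  · have h1 : f y₀ ≤ f y := hmin ⟨hy, hgy⟩
    have h2 : C ≤ g y := hC ⟨y, hy, rfl⟩
    have h3 : -(|C| + 1) ≤ g y := by linarith [neg_abs_le C]
    have h4 := mul_le_mul_of_nonneg_left h3 (by positivity : 0 ≤ f y₀ / (|C| + 1))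
    have h5 : f y₀ / (|C| + 1) * -(|C| + 1) = -f y₀ := by field_simp
    linarith
  · have := hf0 y hy
    have : 0 < g y := not_le.1 hgy
    positivity

theorem continuous_quad (S : Matrix (Fin n) (Fin n) ℝ) :
    Continuous fun x : Fin n → ℝ => x ⬝ᵥ (S *ᵥ x) := by
  unfold dotProduct mulVec dotProduct
  fun_prop

theorem quad_eq_norm_sq_mul (S : Matrix (Fin n) (Fin n) ℝ) (x : Fin n → ℝ) :
    x ⬝ᵥ (S *ᵥ x) = ‖x‖ ^ 2 * ((‖x‖⁻¹ • x) ⬝ᵥ (S *ᵥ (‖x‖⁻¹ • x))) := by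
  rcases eq_or_ne x 0 with rfl | hx
  · simp
  · have := norm_ne_zero_iff.2 hx
    rw [mulVec_smul, dotProduct_smul, smul_dotProduct, smul_smul, smul_eq_mul]
    field_simp

/-- Finsler's lemma. -/
theorem exists_pos_add_smul_posSemidef {Z W : Matrix (Fin n) (Fin n) ℝ} (hZ : Z.PosSemidef)
    (hW : W.IsSymm) (hnn : ∀ k, Z *ᵥ k = 0 → 0 ≤ k ⬝ᵥ (W *ᵥ k))
    (hker : ∀ k, Z *ᵥ k = 0 → k ⬝ᵥ (W *ᵥ k) = 0 → W *ᵥ k = 0) :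
    ∃ ε : ℝ, 0 < ε ∧ (Z + ε • W).PosSemidef := by
  obtain ⟨hZs, hZq⟩ := posSemidef_iff_real.1 hZ
  -- Splitting off the common kernel makes W strictly positive at the nonzero zeros of Z in L, as
  -- the compactness argument on the unit sphere of L requires.
  obtain ⟨L, hL⟩ := Submodule.exists_isCompl (LinearMap.ker Z.mulVecLin ⊓ LinearMap.ker W.mulVecLin)
  have hcomp : IsCompact (Metric.sphere (0 : Fin n → ℝ) 1 ∩ L) :=
    (isCompact_sphere _ _).inter_right L.closed_of_finiteDimensional
  obtain ⟨ε, hε, h⟩ := exists_pos_forall_add_mul_nonneg hcomp (continuous_quad Z)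
    (continuous_quad W) (fun y _ => hZq y) (fun y hy h0 => by
      have hZy := mulVec_eq_zero_of_posSemidef hZ h0
      refine (hnn y hZy).lt_of_ne fun h1 => ?_
      have hWy := hker y hZy h1.symm
      have : y = 0 := (Submodule.disjoint_def.1 hL.disjoint) y ⟨by simpa using hZy,
        by simpa using hWy⟩ hy.2
      simp [this] at hy)
  have hsymm : (Z + ε • W).IsSymm := by simp [IsSymm, hZs.eq, hW.eq]
  refine ⟨ε, hε, posSemidef_iff_real.2 ⟨hsymm, fun x => ?_⟩⟩
  have hx : x ∈ (LinearMap.ker Z.mulVecLin ⊓ LinearMap.ker W.mulVecLin) ⊔ L := by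
    rw [hL.sup_eq_top]; trivial
  obtain ⟨k, ⟨hk1, hk2⟩, l, hl, rfl⟩ := Submodule.mem_sup.1 hx
  have hk : (Z + ε • W) *ᵥ k = 0 := by
    have hk1 : Z *ᵥ k = 0 := by simpa using hk1
    have hk2 : W *ᵥ k = 0 := by simpa using hk2
    rw [add_mulVec, smul_mulVec, hk1, hk2]; simp
  rw [mulVec_add, hk, zero_add, add_dotProduct, dotProduct_mulVec_symm hsymm, hk, dotProduct_zero,
    zero_add]
  rcases eq_or_ne l 0 with rfl | hl0
  · simp
  rw [quad_eq_norm_sq_mul]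
  refine mul_nonneg (by positivity) ?_
  have := h (‖l‖⁻¹ • l) ⟨by simp [norm_smul, norm_ne_zero_iff.2 hl0], L.smul_mem _ hl⟩
  rw [add_mulVec, smul_mulVec, dotProduct_add, dotProduct_smul]
  simpa using this

/-! ### Separating a subspace from the semidefinite cone. -/

/-- Testing the form on e_i ± e_j bounds the entry by the mean of two diagonal entries. This bounds
the trace-one slice, which is therefore compact. -/
theorem abs_apply_le_trace {S : Matrix (Fin n) (Fin n) ℝ} (hS : S.PosSemidef) (i j : Fin n) :
    |S i j| ≤ S.trace := by
  obtain ⟨hs, hq⟩ := posSemidef_iff_real.1 hS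
  have hd : ∀ i, S i i ≤ S.trace := fun i =>
    Finset.single_le_sum (f := fun i => S i i) (fun i _ => hS.diag_nonneg) (Finset.mem_univ i)
  have hij : S j i = S i j := hs.apply i j
  have h1 := hq (Pi.single i 1 + Pi.single j 1)
  have h2 := hq (Pi.single i 1 - Pi.single j 1)
  simp only [mulVec_add, mulVec_sub, dotProduct_add, dotProduct_sub, add_dotProduct,
    sub_dotProduct, mulVec_single_one, single_one_dotProduct, col_apply, hij] at h1 h2
  rw [abs_le]
  constructor <;> linarith [hd i, hd j]

theorem isClosed_setOf_posSemidef : IsClosed {S : Matrix (Fin n) (Fin n) ℝ | S.PosSemidef} := by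
  simp only [posSemidef_iff_real, Set.ofPred_and, Set.ofPred_forall]
  refine IsClosed.inter (isClosed_eq (by fun_prop) (by fun_prop)) (isClosed_iInter fun x => ?_)
  refine isClosed_le continuous_const ?_
  unfold dotProduct mulVec dotProduct
  fun_prop

/-- The positive semidefinite matrices of trace one. -/
theorem isCompact_posSemidef_trace_one :
    IsCompact {S : Matrix (Fin n) (Fin n) ℝ | S.PosSemidef ∧ S.trace = 1} := by
  have hbox : IsCompact (Set.pi Set.univ fun _ : Fin n => Set.pi Set.univ fun _ : Fin n =>
      Set.Icc (-1 : ℝ) 1) :=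
    isCompact_univ_pi fun _ => isCompact_univ_pi fun _ => isCompact_Icc
  refine hbox.of_isClosed_subset
    (isClosed_setOf_posSemidef.inter (isClosed_eq (Continuous.matrix_trace continuous_id)
      continuous_const)) ?_
  rintro S ⟨hS, ht⟩ i - j -
  have := abs_apply_le_trace hS i j
  rw [ht] at this
  exact abs_le.1 this

/-- A subspace of symmetric matrices that meets the positive semidefinite cone only in zero has a
positive definite matrix in its orthogonal complement. -/
theorem exists_posDef_orthogonal (L : Submodule ℝ (Matrix (Fin n) (Fin n) ℝ))
    (hLs : ∀ S ∈ L, S.IsSymm) (hL : ∀ S ∈ L, S.PosSemidef → S = 0) :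
    ∃ Y : Matrix (Fin n) (Fin n) ℝ, Y.PosDef ∧ ∀ S ∈ L, frobInner S Y = 0 := by
  have hconv : Convex ℝ {S : Matrix (Fin n) (Fin n) ℝ | S.PosSemidef ∧ S.trace = 1} := by
    rintro S ⟨hS, hS1⟩ S' ⟨hS', hS1'⟩ a b ha hb hab
    refine ⟨(hS.smul ha).add (hS'.smul hb), ?_⟩
    rw [trace_add, trace_smul, trace_smul, hS1, hS1']
    simpa using hab
  have hdisj : Disjoint {S : Matrix (Fin n) (Fin n) ℝ | S.PosSemidef ∧ S.trace = 1} L := by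
    refine Set.disjoint_left.2 ?_
    rintro S ⟨hS, hS1⟩ hSL
    rw [hL S hSL hS] at hS1
    simp at hS1
  have : LocallyConvexSpace ℝ (Matrix (Fin n) (Fin n) ℝ) :=
    inferInstanceAs (LocallyConvexSpace ℝ (Fin n → Fin n → ℝ))
  obtain ⟨f, u, v, hfu, huv, hvf⟩ := geometric_hahn_banach_compact_closed hconv
    isCompact_posSemidef_trace_one L.convex L.closed_of_finiteDimensional hdisj
  -- A functional bounded below on a subspace vanishes there; otherwise a multiple of S would attain
  -- the excluded value v.
  have hfL : ∀ S ∈ L, f S = 0 := fun S hS => by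
    by_contra h0
    have := hvf ((v / f S) • S) (L.smul_mem _ hS)
    rw [map_smul, smul_eq_mul, div_mul_cancel₀ _ h0] at this
    exact lt_irrefl _ this
  have hv : v < 0 := by simpa using hvf 0 L.zero_mem
  obtain ⟨Y, hY, hfY⟩ := exists_symm_representation (-f.toLinearMap)
  refine ⟨Y, PosDef.of_dotProduct_mulVec_pos (by simpa [IsHermitian, IsSymm] using hY)
    fun x hx => ?_, fun S hS => ?_⟩
  · have hxx : 0 < x ⬝ᵥ x := by simpa using dotProduct_star_self_pos_iff.2 hx
    have hps := posSemidef_vecMulVec_self_star x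
    rw [star_trivial] at hps ⊢
    have ht : (vecMulVec x x).trace = x ⬝ᵥ x := by simp [trace, vecMulVec_apply, dotProduct]
    have := hfu ((x ⬝ᵥ x)⁻¹ • vecMulVec x x) ⟨hps.smul (inv_nonneg.2 hxx.le), by
      rw [trace_smul, ht, smul_eq_mul, inv_mul_cancel₀ hxx.ne']⟩
    rw [map_smul, smul_eq_mul] at this
    have hneg : f (vecMulVec x x) < 0 := by
      by_contra h
      have : 0 ≤ (x ⬝ᵥ x)⁻¹ * f (vecMulVec x x) := mul_nonneg (inv_nonneg.2 hxx.le) (not_lt.1 h)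
      linarith
    have h2 := hfY _ (posSemidef_iff_real.1 hps).1
    rw [frobInner_comm, frobInner_vecMulVec] at h2
    rw [← h2]
    simpa using hneg
  · rw [← hfY S (hLs S hS)]
    simp [hfL S hS]

/-! ### Strong duality under Slater's condition. -/

/-- Matrices, not necessarily symmetric, with a positive quadratic form. -/
def quadPos (n : ℕ) : Set (Matrix (Fin n) (Fin n) ℝ) :=
  {S | ∀ x : Fin n → ℝ, x ≠ 0 → 0 < x ⬝ᵥ (S *ᵥ x)}

/-- By homogeneity it suffices to test positivity on the compact unit sphere. Dropping symmetry is
what makes the set open in the full matrix space, as separation needs. -/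
theorem isOpen_quadPos : IsOpen (quadPos n) := by
  have heq : quadPos n =
      {S | ∀ x ∈ Metric.sphere (0 : Fin n → ℝ) 1, 0 < x ⬝ᵥ (S *ᵥ x)} := by
    ext S
    refine ⟨fun h x hx => h x ?_, fun h x hx => ?_⟩
    · rintro rfl
      simp at hx
    · rw [quad_eq_norm_sq_mul]
      have := norm_pos_iff.2 hx
      exact mul_pos (by positivity) (h _ (by simp [norm_smul, this.ne']))
  rw [heq, isOpen_iff_mem_nhds]
  intro S hS
  refine (isCompact_sphere (0 : Fin n → ℝ) 1).eventually_forall_of_forall_eventually fun x hx => ?_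
  have hc : Continuous fun z : Matrix (Fin n) (Fin n) ℝ × (Fin n → ℝ) => z.2 ⬝ᵥ (z.1 *ᵥ z.2) := by
    unfold dotProduct mulVec dotProduct
    fun_prop
  exact (isOpen_lt continuous_const hc).mem_nhds (hS x hx)

theorem convex_quadPos : Convex ℝ (quadPos n) := by
  intro S hS S' hS' s t hs ht hst x hx
  rw [add_mulVec, smul_mulVec, smul_mulVec, dotProduct_add, dotProduct_smul, dotProduct_smul,
    smul_eq_mul, smul_eq_mul]
  have h1 := hS x hx
  have h2 := hS' x hx
  rcases hs.eq_or_lt with rfl | hs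
  · have : t = 1 := by linarith
    subst this; linarith
  · have := mul_pos hs h1
    have := mul_nonneg ht h2.le
    linarith

theorem smul_mem_quadPos {S : Matrix (Fin n) (Fin n) ℝ} (hS : S ∈ quadPos n) {t : ℝ}
    (ht : 0 < t) : t • S ∈ quadPos n := fun x hx => by
  rw [smul_mulVec, dotProduct_smul]
  exact mul_pos ht (hS x hx)

theorem _root_.Matrix.PosSemidef.add_mem_quadPos {S H : Matrix (Fin n) (Fin n) ℝ} (hS : S.PosSemidef)
    (hH : H ∈ quadPos n) : S + H ∈ quadPos n := fun x hx => by
  rw [add_mulVec, dotProduct_add]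
  exact add_pos_of_nonneg_of_pos ((posSemidef_iff_real.1 hS).2 x) (hH x hx)

theorem _root_.Matrix.PosDef.mem_quadPos {H : Matrix (Fin n) (Fin n) ℝ} (hH : H.PosDef) :
    H ∈ quadPos n := fun x hx => by simpa using hH.dotProduct_mulVec_pos hx

/-- No x has slack in P and value above v, so the open convex set P × (v, ∞) misses the affine set
of pairs (H - a x, c x), and Hahn–Banach applies. -/
theorem exists_separating_functional {E X : Type*} [AddCommGroup E] [Module ℝ E]
    [TopologicalSpace E] [IsTopologicalAddGroup E] [ContinuousSMul ℝ E]
    [AddCommGroup X] [Module ℝ X] {P : Set E} (hPo : IsOpen P) (hPc : Convex ℝ P)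
    (a : X →ₗ[ℝ] E) (c : X →ₗ[ℝ] ℝ) (H : E) {v : ℝ} (hv : ∀ x, H - a x ∈ P → c x ≤ v) :
    ∃ (φ : E →ₗ[ℝ] ℝ) (μ u : ℝ), (∀ S ∈ P, ∀ s, v < s → φ S + s * μ < u) ∧
      ∀ x, u ≤ φ H - φ (a x) + c x * μ := by
  have hG : Convex ℝ (Set.range fun x => (H - a x, c x)) := by
    rintro _ ⟨x, rfl⟩ _ ⟨y, rfl⟩ s t hs ht hst
    refine ⟨s • x + t • y, ?_⟩
    have h1 : s • H + t • H = H := by rw [← add_smul, hst, one_smul]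
    refine Prod.ext ?_ (by simp)
    simp only [map_add, map_smul, Prod.fst_add, Prod.smul_fst, smul_sub]
    nth_rewrite 1 [← h1]
    abel
  have hdisj : Disjoint (P ×ˢ Set.Ioi v) (Set.range fun x => (H - a x, c x)) := by
    refine Set.disjoint_left.2 ?_
    rintro _ ⟨h1, h2⟩ ⟨x, rfl⟩
    exact (Set.mem_Ioi.1 h2).not_ge (hv x h1)
  obtain ⟨f, u, hfu, huf⟩ := geometric_hahn_banach_open (hPc.prod (convex_Ioi v))
    (hPo.prod isOpen_Ioi) hG hdisj
  have hf : ∀ S s, f (S, s) = f (S, 0) + s * f (0, 1) := fun S s => by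
    rw [← smul_eq_mul, ← map_smul, ← map_add]
    simp
  refine ⟨f.toLinearMap ∘ₗ LinearMap.inl ℝ _ ℝ, f (0, 1), u, fun S hS s hs => ?_, fun x => ?_⟩
  · have := hfu (S, s) ⟨hS, hs⟩
    rw [hf] at this
    exact this
  · have := huf _ ⟨x, rfl⟩
    rw [hf] at this
    rw [← map_sub]
    exact this

theorem nonpos_of_forall_pos_le_mul {p b : ℝ} (h : ∀ ε : ℝ, 0 < ε → p ≤ ε * b) : p ≤ 0 := by
  refine le_of_forall_pos_le_add fun δ hδ => ?_
  have h1 := h (δ / (|b| + 1)) (by positivity)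
  have h2 : δ / (|b| + 1) * b ≤ δ := by
    rw [div_mul_eq_mul_div, div_le_iff₀ (by positivity)]
    exact mul_le_mul_of_nonneg_left (by linarith [le_abs_self b]) hδ.le
  linarith

/-- Strong duality for a linear family `a` of symmetric matrices under Slater's condition: `H` is
positive definite. -/
theorem exists_dual_of_posDef {X : Type*} [AddCommGroup X] [Module ℝ X]
    (a : X →ₗ[ℝ] Matrix (Fin n) (Fin n) ℝ) (c : X →ₗ[ℝ] ℝ) (ha : ∀ x, (a x).IsSymm)
    {H : Matrix (Fin n) (Fin n) ℝ} (hH : H.PosDef) {v : ℝ}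
    (hv : ∀ x, (H - a x).PosSemidef → c x ≤ v) :
    ∃ Y : Matrix (Fin n) (Fin n) ℝ, Y.PosSemidef ∧ (∀ x, frobInner (a x) Y = c x) ∧
      frobInner H Y ≤ v := by
  have hHs : H.IsSymm := (posSemidef_iff_real.1 hH.posSemidef).1
  have hHP := hH.mem_quadPos
  obtain ⟨φ, μ, u, hU', hG'⟩ := exists_separating_functional isOpen_quadPos convex_quadPos a c H fun x hx =>
    hv x (posSemidef_iff_real.2 ⟨hHs.sub (ha x), fun z => by
      rcases eq_or_ne z 0 with rfl | hz
      · simp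
      · exact (hx z hz).le⟩)
  have hG0 : u ≤ φ H := by simpa using hG' 0
  -- Slater's condition excludes a vertical hyperplane: H is in the open cone and is also the slack
  -- at x = 0.
  have hμ0 : μ < 0 := by
    have := hU' H hHP (|v| + 1) (by linarith [le_abs_self v])
    by_contra h
    have : 0 ≤ (|v| + 1) * μ := mul_nonneg (by positivity) (not_lt.1 h)
    linarith
  -- An affine function of x bounded below on the whole space is constant; the multiple of x is
  -- chosen to undercut the bound by 1.
  have hlin : ∀ x, φ (a x) = c x * μ := fun x => by
    by_contra h0
    have h1 : c x * μ - φ (a x) ≠ 0 := fun h => h0 (by linarith)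
    have h2 := hG' (((u - φ H - 1) / (c x * μ - φ (a x))) • x)
    simp only [map_smul, smul_eq_mul] at h2
    have h3 : (u - φ H - 1) / (c x * μ - φ (a x)) * (c x * μ - φ (a x)) = u - φ H - 1 :=
      div_mul_cancel₀ _ h1
    nlinarith
  have hφP : ∀ S ∈ quadPos n, φ S ≤ 0 := fun S hS => by
    by_contra h
    have hp : 0 < φ S := not_le.1 h
    have hv1 := hU' (((|u - (v + 1) * μ| + 1) / φ S) • S) (smul_mem_quadPos hS (by positivity)) (v + 1) (by linarith)
    rw [map_smul, smul_eq_mul, div_mul_cancel₀ _ hp.ne'] at hv1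
    linarith [le_abs_self (u - (v + 1) * μ)]
  have hvu : v * μ ≤ u := by
    refine sub_nonpos.1 (nonpos_of_forall_pos_le_mul (b := -φ H - μ) fun ε hε => ?_)
    have := hU' (ε • H) (smul_mem_quadPos hHP hε) (v + ε) (by linarith)
    rw [map_smul, smul_eq_mul] at this
    linarith
  obtain ⟨Y, hY, hφY⟩ := exists_symm_representation (μ⁻¹ • φ)
  refine ⟨Y, posSemidef_iff_real.2 ⟨hY, fun x => ?_⟩, fun x => ?_, ?_⟩
  · have hps := posSemidef_vecMulVec_self_star x
    rw [star_trivial] at hps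
    rw [← frobInner_vecMulVec, frobInner_comm, ← hφY _ (posSemidef_iff_real.1 hps).1]
    have hle : φ (vecMulVec x x) ≤ 0 := by
      refine nonpos_of_forall_pos_le_mul (b := -φ H) fun ε hε => ?_
      have := hφP _ (hps.add_mem_quadPos (smul_mem_quadPos hHP hε))
      rw [map_add, map_smul, smul_eq_mul] at this
      linarith
    exact mul_nonneg_of_nonpos_of_nonpos (inv_nonpos.2 hμ0.le) hle
  · rw [← hφY _ (ha x), LinearMap.smul_apply, hlin, smul_eq_mul]
    rw [mul_comm (c x), inv_mul_cancel_left₀ hμ0.ne]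
  · rw [← hφY _ hHs, LinearMap.smul_apply, smul_eq_mul]
    have h1 : μ⁻¹ * φ H ≤ μ⁻¹ * (v * μ) :=
      mul_le_mul_of_nonpos_left (hvu.trans hG0) (inv_nonpos.2 hμ0.le)
    have h2 : μ⁻¹ * (v * μ) = v := by field_simp [hμ0.ne]
    linarith

/-! ### Without a critical direction the system is well-behaved. -/

/-- The absence of a critical direction is the kernel hypothesis of Finsler's lemma, so Z + εW is a
slack. Every slack kills ker Z, and hence so does W. -/
theorem mul_eq_zero_of_compress_posSemidef {A : Fin m → Matrix (Fin n) (Fin n) ℝ}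
    {B Z Q G : Matrix (Fin n) (Fin n) ℝ} (hA : ∀ i, (A i).IsSymm) (hZ : IsMaxRankSlack A B Z)
    (hcrit : ¬ HasCriticalDirection A Z) (hQ : Q.IsSymm) (hZQ : Z * Q = 0) (hG : 1 - Q = G * Z)
    {x : Fin m → ℝ} (hx : (Q * (∑ i, x i • A i) * Q).PosSemidef) :
    (∑ i, x i • A i) * Q = 0 := by
  have hW := isSymm_sum_smul hA x
  obtain ⟨x₀, -, hx₀⟩ := hZ.1
  set W := ∑ i, x i • A i with hWdef
  have hnn : ∀ k, Z *ᵥ k = 0 → 0 ≤ k ⬝ᵥ (W *ᵥ k) := fun k hk => by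
    have h1 := rotate_quad Q W k k
    rw [rotate, hQ.eq, mulVec_kernel_projection hG hk] at h1
    rw [← h1]
    exact (posSemidef_iff_real.1 hx).2 k
  have hker : ∀ k, Z *ᵥ k = 0 → k ⬝ᵥ (W *ᵥ k) = 0 → W *ᵥ k = 0 := fun k hk h0 => by
    by_contra hne
    exact hcrit ⟨x, k, hk, hnn, h0, hne⟩
  obtain ⟨ε, hε, hps⟩ := exists_pos_add_smul_posSemidef hZ.1.posSemidef hW hnn hker
  have hslack : Z + ε • W = B - ∑ i, (x₀ - ε • x) i • A i := by
    simp only [hx₀, hWdef, Pi.sub_apply, Pi.smul_apply, smul_eq_mul, sub_smul, mul_smul,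
      Finset.sum_sub_distrib, ← Finset.smul_sum]
    abel
  have hmem : x₀ - ε • x ∈ feasibleSet A B := by
    show PosSemidef _
    rwa [← hslack]
  refine Matrix.ext_of_mulVec_single fun j => ?_
  have hk : Z *ᵥ (Q *ᵥ Pi.single j 1) = 0 := by rw [mulVec_mulVec, hZQ, zero_mulVec]
  have h1 := hZ.mulVec_eq_zero ⟨_, hmem, hslack⟩ hk
  rw [add_mulVec, hk, zero_add, smul_mulVec, smul_eq_zero] at h1
  rw [← mulVec_mulVec, h1.resolve_left hε.ne', zero_mulVec]

/-- A functional vanishing on the kernel of b factors through b. -/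
theorem exists_symm_frobInner_eq {X : Type*} [AddCommGroup X] [Module ℝ X]
    (b : X →ₗ[ℝ] Matrix (Fin n) (Fin n) ℝ) (d : X →ₗ[ℝ] ℝ) (hb : ∀ x, (b x).IsSymm)
    (hker : ∀ x, b x = 0 → d x = 0) :
    ∃ W : Matrix (Fin n) (Fin n) ℝ, W.IsSymm ∧ ∀ x, frobInner (b x) W = d x := by
  have hd : d ∈ (LinearMap.ker b).dualAnnihilator :=
    (Submodule.mem_dualAnnihilator d).2 fun x hx => hker x hx
  rw [← LinearMap.range_dualMap_eq_dualAnnihilator_ker] at hd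
  obtain ⟨ψ, rfl⟩ := hd
  obtain ⟨W, hW, h⟩ := exists_symm_representation ψ
  exact ⟨W, hW, fun x => (h _ (hb x)).symm⟩

theorem conj_eq_self_of_mul_eq_zero {M Q : Matrix (Fin n) (Fin n) ℝ} (hM : M.IsSymm)
    (hQ : Q.IsSymm) (h : M * Q = 0) : (1 - Q) * M * (1 - Q) = M := by
  have h' : Q * M = 0 := by
    have := congrArg transpose h
    simpa [hM.eq, hQ.eq] using this
  rw [sub_mul, one_mul, h', sub_zero, mul_sub, mul_one, h, sub_zero]

theorem wellBehaved_of_not_hasCriticalDirection {A : Fin m → Matrix (Fin n) (Fin n) ℝ}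
    {B Z : Matrix (Fin n) (Fin n) ℝ} (hA : ∀ i, (A i).IsSymm) (hZ : IsMaxRankSlack A B Z)
    (hcrit : ¬ HasCriticalDirection A Z) : WellBehaved A B := by
  intro c v hv
  have hZp := hZ.1.posSemidef
  have hZs := (posSemidef_iff_real.1 hZp).1
  obtain ⟨x₀, hx₀, hZx⟩ := hZ.1
  obtain ⟨Q, G, hQ, hQQ, hZQ, hG⟩ := exists_kernel_projection hZs
  have hkey := fun x => mul_eq_zero_of_compress_posSemidef (x := x) hA hZ hcrit hQ hZQ hG
  have hH := posDef_add_kernel_projection hZp hQ hQQ hG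
  have hR : (1 - Q).IsSymm := isSymm_one.sub hQ
  let a : (Fin m → ℝ) →ₗ[ℝ] Matrix (Fin n) (Fin n) ℝ := Fintype.linearCombination ℝ A
  have ha : ∀ x, a x = ∑ i, x i • A i := fun x => rfl
  have has : ∀ x, (a x).IsSymm := isSymm_sum_smul hA
  simp only [← ha] at hkey hZx
  let c' : (Fin m → ℝ) →ₗ[ℝ] ℝ := Fintype.linearCombination ℝ c
  have hc' : ∀ x, c' x = ∑ i, c i * x i := fun x => by
    simp [c', Fintype.linearCombination_apply, mul_comm]
  have hle : ∀ x, (B - a x).PosSemidef → c' x ≤ v := fun x hx => by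
    rw [hc']
    exact hv.1 ⟨x, hx, rfl⟩
  let N : Submodule ℝ (Fin m → ℝ) := LinearMap.ker (LinearMap.mulRight ℝ Q ∘ₗ a)
  have hN : ∀ x, x ∈ N ↔ a x * Q = 0 := fun x => by simp [N]
  -- Adding Q to Z creates a Slater point without changing the bound: for x in N, compressing by 1 -
  -- Q removes Q and shows that x₀ + x is feasible.
  obtain ⟨Y₁, hY₁, haY₁, hHY₁⟩ := exists_dual_of_posDef (a ∘ₗ N.subtype) (c' ∘ₗ N.subtype)
    (fun x => has x) hH (v := v - c' x₀) (by
      rintro ⟨x, hx⟩ hps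
      have hx := (hN x).1 hx
      have h1 := conj_eq_self_of_mul_eq_zero (hZs.sub (has x)) hQ (by rw [sub_mul, hZQ, hx, sub_zero])
      have h2 := hps.conjTranspose_mul_mul_same (1 - Q)
      have h3 : (1 - Q)ᴴ * (Z + Q - a x) * (1 - Q) = B - a (x₀ + x) := by
        have hq : (1 - Q) * Q = 0 := by rw [sub_mul, one_mul, hQQ, sub_self]
        rw [conjTranspose_eq_transpose_of_trivial, hR.eq,
          show Z + Q - a x = (Z - a x) + Q by abel, mul_add, add_mul, h1, hq, zero_mul, add_zero,
          hZx, map_add]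
        abel
      have h4 : (B - a (x₀ + x)).PosSemidef := h3 ▸ h2
      have := hle _ h4
      rw [map_add] at this
      show c' x ≤ v - c' x₀
      linarith)
  have hY₂ : ((1 - Q) * Y₁ * (1 - Q)).PosSemidef := by
    have := hY₁.conjTranspose_mul_mul_same (1 - Q)
    rwa [conjTranspose_eq_transpose_of_trivial, hR.eq] at this
  set Y₂ := (1 - Q) * Y₁ * (1 - Q) with hY₂def
  have hZY₂ : frobInner Z Y₂ ≤ v - c' x₀ := by
    have hQp : Q.PosSemidef := by
      rw [← hQQ]
      nth_rewrite 1 [← hQ.eq]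
      exact posSemidef_conjTranspose_mul_self Q
    rw [hY₂def, frobInner_conj _ _ _ hR, conj_eq_self_of_mul_eq_zero hZs hQ hZQ]
    rw [frobInner_add_left] at hHY₁
    linarith [frobInner_nonneg hQp hY₁]
  let b : (Fin m → ℝ) →ₗ[ℝ] Matrix (Fin n) (Fin n) ℝ :=
    LinearMap.mulRight ℝ Q ∘ₗ LinearMap.mulLeft ℝ Q ∘ₗ a
  have hb : ∀ x, b x = Q * a x * Q := fun x => rfl
  have hbs : ∀ x, (b x).IsSymm := fun x => by
    simp [IsSymm, hb, transpose_mul, hQ.eq, (has x).eq, mul_assoc]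
  obtain ⟨Y₀, hY₀, hbY₀⟩ := exists_posDef_orthogonal (LinearMap.range b)
    (by rintro _ ⟨x, rfl⟩; exact hbs x)
    (by
      rintro _ ⟨x, rfl⟩ hps
      rw [hb, mul_assoc, hkey x hps, mul_zero])
  -- Y₂ meets the dual equations on N; W represents the defect elsewhere. The defect vanishes on ker
  -- b because b x = 0 is trivially semidefinite, which puts x in N.
  obtain ⟨W, hW, hbW⟩ := exists_symm_frobInner_eq b (c' - (frobForm n).flip Y₂ ∘ₗ a) hbs (by
    intro x hx
    have h1 := hkey x (by rw [← hb, hx]; exact PosSemidef.zero)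
    have h2 : frobInner (a x) Y₁ = c' x := haY₁ ⟨x, (hN x).2 h1⟩
    show c' x - frobInner (a x) Y₂ = 0
    rw [hY₂def, frobInner_conj _ _ _ hR, conj_eq_self_of_mul_eq_zero (has x) hQ h1, h2, sub_self])
  have hbW : ∀ x, frobInner (b x) W = c' x - frobInner (a x) Y₂ := hbW
  have hY₀k : ∀ k, Y₀ *ᵥ k = 0 → k = 0 := fun k hk => by
    by_contra h
    have := hY₀.dotProduct_mulVec_pos h
    rw [hk, dotProduct_zero] at this
    exact lt_irrefl _ this
  -- Y₀ has trivial kernel, so the hypotheses of Finsler's lemma hold trivially. Dividing by ε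
  -- restores the coefficient of W, and Y₀ does not disturb the equations.
  obtain ⟨ε, hε, hps⟩ := exists_pos_add_smul_posSemidef hY₀.posSemidef hW
    (fun k hk => by rw [hY₀k k hk]; simp) (fun k hk _ => by rw [hY₀k k hk]; simp)
  set Y₃ := ε⁻¹ • (Y₀ + ε • W) with hY₃def
  have hY₃ : Y₃.PosSemidef := hps.smul (inv_nonneg.2 hε.le)
  have hbY₃ : ∀ x, frobInner (b x) Y₃ = c' x - frobInner (a x) Y₂ := fun x => by
    rw [hY₃def, frobInner_smul_right, frobInner_add_right, frobInner_smul_right,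
      hbY₀ _ ⟨x, rfl⟩, zero_add, inv_mul_cancel_left₀ hε.ne', hbW]
  have hY : (Y₂ + Q * Y₃ * Q).PosSemidef := by
    have := hY₃.conjTranspose_mul_mul_same Q
    rw [conjTranspose_eq_transpose_of_trivial, hQ.eq] at this
    exact hY₂.add this
  have haY : ∀ x, frobInner (a x) (Y₂ + Q * Y₃ * Q) = c' x := fun x => by
    rw [frobInner_add_right, frobInner_conj _ _ _ hQ, ← hb, hbY₃]
    ring
  have hBZ : B = Z + a x₀ := by rw [hZx]; abel
  refine ⟨Y₂ + Q * Y₃ * Q, ⟨hY, fun i => ?_⟩, le_antisymm ?_ (hv.2 ?_)⟩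
  · have := haY (Pi.single i 1)
    simpa [a, c', Fintype.linearCombination_apply_single] using this
  · rw [hBZ, frobInner_add_left, haY, frobInner_add_right, frobInner_conj _ _ _ hQ, mul_assoc, hZQ,
      mul_zero, frobInner_zero_left]
    linarith
  · rintro _ ⟨x, hx, rfl⟩
    have h1 := frobInner_nonneg hx hY
    rw [← ha, frobInner_sub_left, haY] at h1
    show ∑ i, c i * x i ≤ _
    rw [← hc']
    linarith

end SDPSystem

theorem theorem1p1 (m n : ℕ) (A : Fin m → Matrix (Fin n) (Fin n) ℝ)
    (B : Matrix (Fin n) (Fin n) ℝ) (hA : ∀ i, (A i).IsSymm) (hB : B.IsSymm)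
    (Z : Matrix (Fin n) (Fin n) ℝ) (hZ : SDPSystem.IsMaxRankSlack A B Z) :
    SDPSystem.BadlyBehaved A B ↔
      ∃ T : Matrix (Fin n) (Fin n) ℝ, IsUnit T ∧
        SDPSystem.rotate T Z = SDPSystem.idZero n Z.rank ∧
        ∃ V : Matrix (Fin n) (Fin n) ℝ,
          SDPSystem.IsLinComb (fun i => SDPSystem.rotate T (A i)) (SDPSystem.rotate T B) V ∧
          SDPSystem.HasBadForm Z.rank V := by
  constructor
  · intro hbad
    by_cases hcrit : SDPSystem.HasCriticalDirection A Z
    · exact hcrit.exists_hasBadForm B hA hZ.1.posSemidef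
    · exact absurd (SDPSystem.wellBehaved_of_not_hasCriticalDirection hA hZ hcrit) hbad
  · rintro ⟨T, hT, hTZ, V, hV, hform⟩
    exact (SDPSystem.hasCriticalDirection_of_hasBadForm hZ.1 hT hTZ hV hform).badlyBehaved hZ
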